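/- **Theorem (second-order tangent sets of spectral sets).** Let $\mathbf S^n$ be the space of real symmetric $n\times n$ matrices and, for $X\in\mathbf S^n$, let $\lambda(X)=(\lambda_1(X),\dots,\lambda_n(X))\in\mathbb R^n$ be the vector of eigenvalues of $X$, with multiplicity, in nonincreasing order. For $X,H,W\in\mathbf S^n$ put, for $i=1,\dots,n$, $$\lambda_i'(X;H)=\lim_{t\downarrow0}\frac{\lambda_i(X+tH)-\lambda_i(X)}{t},\qquad \lambda_i''(X;H,W)=\lim_{t\downarrow0}\frac{\lambda_i(X+tH+\frac12t^2W)-\lambda_i(X)-t\lambda_i'(X;H)}{\frac12t^2},$$ $\lambda'(X;H)=(\lambda_i'(X;H))_{i}$ and $\lambda''(X;H,W)=(\lambda_i''(X;H,W))_{i}$. For a subset $C$ of a finite-dimensional real Hilbert space $\mathbf X$ and $x\in C$, let $$T_C(x)=\{w\in\mathbf X : \exists\, t_k\downarrow0,\ w_k\to w \text{ with } x+t_kw_k\in C \text{ for all } k\},$$ and, for $w\in T_C(x)$, let $$T_C^2(x,w)=\{u\in\mathbf X : \exists\, t_k\downarrow0,\ u_k\to u \text{ with } x+t_kw+\tfrac12t_k^2u_k\in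 C \text{ for all } k\}.$$ (Here $t_k\downarrow 0$ means $t_k>0$ and $t_k\to0$.) The set $C$ is *parabolically derivable at $x$ for $w$* if $T_C^2(x,w)\neq\emptyset$ and for each $u\in T_C^2(x,w)$ there are $\varepsilon>0$ and a map $\xi:[0,\varepsilon]\to C$ with $\xi(0)=x$, $\lim_{t\downarrow0}[\xi(t)-\xi(0)]/t=w$ and $\lim_{t\downarrow0}[\xi(t)-\xi(0)-tw]/(\frac12t^2)=u$. Let $\Theta\subset\mathbb R^n$ be a symmetric set (invariant under all permutations of coordinates), let $C=\{X\in\mathbf S^n : \lambda(X)\in\Theta\}$ be the corresponding spectral set, and let $X\in C$ and $H\in T_C(X)$. Then the limits defining $\lambda'(X;H)$ and $\lambda''(X;H,W)$, $W\in\mathbf S^n$, exist, and $$T_C^2(X,H)=\{W\in\mathbf S^n : \lambda''(X;H,W)\in T^2_\Theta(\lambda(X),\lambda'(X;H))\}.$$ Moreover: (a) If $\Theta$ is parabolically derivable at $\lambda(X)$ for $\lambda'(X;H)$, then $C$ is parabolically derivable at $X$ for $H$. (b) If $C$ is parabolically derivable at $X$ for every $H'\in T_C(X)$, then $\Theta$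 is parabolically derivable at $\lambda(X)$ for every $v\in T_\Theta(\lambda(X))$. -/

import Mathlib

open Filter Topology

namespace SpectralVar

section TangentSets

variable {E : Type*} [AddCommGroup E] [Module ℝ E] [TopologicalSpace E]

/-- The (Bouligand) tangent cone `T_C(x)`: all limits of sequences `w_k` with `x + t_k w_k ∈ C`
for some `t_k ↓ 0`. Only the topology of `E` matters (in a finite-dimensional space, all norms
give the same tangent sets). -/
def tangentCone (C : Set E) (x : E) : Set E :=
  {w | ∃ (t : ℕ → ℝ) (v : ℕ → E), (∀ k, 0 < t k) ∧ Tendsto t atTop (𝓝 0) ∧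
    Tendsto v atTop (𝓝 w) ∧ ∀ k, x + t k • v k ∈ C}

/-- The second-order tangent set `T²_C(x, w)`: all limits of sequences `u_k` with
`x + t_k w + (1/2) t_k² u_k ∈ C` for some `t_k ↓ 0`. -/
def tangentSet2 (C : Set E) (x w : E) : Set E :=
  {u | ∃ (t : ℕ → ℝ) (v : ℕ → E), (∀ k, 0 < t k) ∧ Tendsto t atTop (𝓝 0) ∧
    Tendsto v atTop (𝓝 u) ∧ ∀ k, x + t k • w + (1 / 2 * t k ^ 2) • v k ∈ C}

/-- Parabolic derivability of `C` at `x` for `w`: the second-order tangent set `T²_C(x, w)` is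
nonempty, and each of its elements `u` is the second-order right derivative `ξ''₊(0)` of some arc
`ξ : [0, ε] → C` with `ξ(0) = x` and `ξ'₊(0) = w`. (Only the values of `ξ` on `[0, ε]` matter.) -/
def ParabolicallyDerivable (C : Set E) (x w : E) : Prop :=
  (tangentSet2 C x w).Nonempty ∧
    ∀ u ∈ tangentSet2 C x w, ∃ ε > (0 : ℝ), ∃ ξ : ℝ → E,
      (∀ t ∈ Set.Icc 0 ε, ξ t ∈ C) ∧ ξ 0 = x ∧
      Tendsto (fun t : ℝ => t⁻¹ • (ξ t - ξ 0)) (𝓝[>] 0) (𝓝 w) ∧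
      Tendsto (fun t : ℝ => (1 / 2 * t ^ 2)⁻¹ • (ξ t - ξ 0 - t • w)) (𝓝[>] 0) (𝓝 u)

end TangentSets

/-- The space `Sⁿ` of real symmetric `n × n` matrices (over `ℝ`, self-adjoint means `Xᵀ = X`). -/
abbrev Sym (n : ℕ) : Type := selfAdjoint.submodule ℝ (Matrix (Fin n) (Fin n) ℝ)

/-- `λ(X) = (λ₁(X), …, λₙ(X))`: the eigenvalues of `X`, repeated according to multiplicity, in
nonincreasing order. -/
noncomputable def eig {n : ℕ} (X : Sym n) : Fin n → ℝ := fun i =>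
  Matrix.IsHermitian.eigenvalues₀ (A := (X : Matrix (Fin n) (Fin n) ℝ)) X.2
    (Fin.cast (Fintype.card_fin n).symm i)

theorem eig_antitone {n : ℕ} (X : Sym n) : Antitone (eig X) := fun _ _ h =>
  Matrix.IsHermitian.eigenvalues₀_antitone _ (by simpa using h)

/-- The first-order difference quotient `(λᵢ(X + tH) - λᵢ(X)) / t`. -/
noncomputable def eigQuot {n : ℕ} (X H : Sym n) (i : Fin n) (t : ℝ) : ℝ :=
  (eig (X + t • H) i - eig X i) / t

/-- The directional derivative `λ'(X; H)`, componentwise the limit as `t ↓ 0` of the first-order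
difference quotients. -/
noncomputable def eigDeriv {n : ℕ} (X H : Sym n) : Fin n → ℝ := fun i =>
  limUnder (𝓝[>] (0 : ℝ)) (eigQuot X H i)

/-- The second-order difference quotient
`(λᵢ(X + tH + (1/2)t²W) - λᵢ(X) - t λᵢ'(X; H)) / ((1/2)t²)`. -/
noncomputable def eigQuot2 {n : ℕ} (X H W : Sym n) (i : Fin n) (t : ℝ) : ℝ :=
  (eig (X + t • H + (1 / 2 * t ^ 2) • W) i - eig X i - t * eigDeriv X H i) / (1 / 2 * t ^ 2)

/-- The parabolic second-order directional derivative `λ''(X; H, W)`, componentwise the limit as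
`t ↓ 0` of the second-order difference quotients. -/
noncomputable def eigDeriv2 {n : ℕ} (X H W : Sym n) : Fin n → ℝ := fun i =>
  limUnder (𝓝[>] (0 : ℝ)) (eigQuot2 X H W i)

/-- `Θ ⊆ ℝⁿ` is symmetric if it is invariant under permutations of the coordinates. -/
def IsSymmetricSet {n : ℕ} (Θ : Set (Fin n → ℝ)) : Prop :=
  ∀ (σ : Equiv.Perm (Fin n)) (x : Fin n → ℝ), x ∘ σ ∈ Θ ↔ x ∈ Θ

/-- The spectral set `{X ∈ Sⁿ | λ(X) ∈ Θ}`. -/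
def spectralSet {n : ℕ} (Θ : Set (Fin n → ℝ)) : Set (Sym n) :=
  {X | eig X ∈ Θ}

end SpectralVar

/-!
The proof rests on two facts about the eigenvalue map `λ`.

**Second-order expansion.** For fixed symmetric `X`, `H`, `G` there are vectors with
`λ(X + tH + t²G) = x + td + t²g + O(t³)` as `t ↓ 0` (`hasExpansion`). If `K` and `L` are
skew-symmetric, conjugating the curve by the Cayley transform of `-(tK + t²L)` replaces `H` by
`H + 2[X, K]` and `G` by `G + [2H + 2[X, K], K] + 2[X, L]`, up to an error `O(t³)`, which changes the
eigenvalues by `O(t³)` because of Weyl's inequality (`norm_eig_sub_le`). A first choice of `K` makes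
`H` commute with `X`; once `X` and `H` are diagonal, a second choice, with `[X, K] = 0`, makes `G`
commute with both. Then `X`, `H`, `G` are diagonal in one orthonormal basis, and for small `t > 0`
the eigenvalues are the numbers `xᵢ + t dᵢ + t² gᵢ`, whose order no longer depends on `t`. By Weyl's
inequality again, `d` is the same for all `G`. The limits defining `λ'(X; H)` and `λ''(X; H, W)` are
read off from this expansion (`tendsto_eigQuot`, `tendsto_eigQuot2`).

**Lifting.** If `Z = U diag(λ(Z)) Uᵀ`, then `y ↦ U diag(y) Uᵀ` maps the symmetric set `Θ` into the
spectral set, and the distance from `Z` to the image of `y` is the distance from `λ(Z)` to `y`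
(`exists_lift`). With `Z = X + tH + (t²/2)W` this turns points or arcs of `Θ` with second-order
behaviour `λ''(X; H, W)` into points or arcs of the spectral set with second-order behaviour `W`
(`tendsto_lift`). In the other direction `λ` itself does this, by Weyl's inequality
(`tendsto_eig_of_tendsto`). This gives the chain rule and the arcs in (a). Nonemptiness in (a)
follows by compactness, lifting along `Z = X + tH`: as `λ''(X; H, 0)` exists, the second-order
difference quotients of the lifted points stay bounded.

For (b), take `H = U diag(v) Uᵀ` and `W = U diag(u) Uᵀ`, where `X = U diag(λ(X)) Uᵀ`. Then
`λ(X + tH + (t²/2)W)` is a permutation of `λ(X) + tv + (t²/2)u`, and the inverse permutation brings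
the eigenvalues of nearby matrices of the spectral set to points of `Θ` near
`λ(X) + tv + (t²/2)u` (`exists_mem_norm_sub_le`).
-/

namespace SpectralVar

/-! ### Eigenvalues, orthogonal conjugation and Weyl's inequality -/

section Eigenvalues

open Matrix
open scoped Matrix.Norms.L2Operator

variable {n : ℕ}

theorem eq_of_antitone_of_map_univ_eq {f g : Fin n → ℝ} (hf : Antitone f) (hg : Antitone g)
    (h : Multiset.map f Finset.univ.val = Multiset.map g Finset.univ.val) : f = g := by
  rw [Fin.univ_val_map, Fin.univ_val_map, Multiset.coe_eq_coe] at h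
  exact List.ofFn_inj.1 (h.eq_of_pairwise' (List.sortedGE_ofFn_iff.2 hf).pairwise
    (List.sortedGE_ofFn_iff.2 hg).pairwise)

theorem map_eig_univ (X : Sym n) :
    Multiset.map (eig X) Finset.univ.val = (X : Matrix (Fin n) (Fin n) ℝ).charpoly.roots := by
  have h := IsHermitian.roots_charpoly_eq_eigenvalues₀
    (A := (X : Matrix (Fin n) (Fin n) ℝ)) X.2
  rw [h, ← Multiset.map_univ_val_equiv (finCongr (Fintype.card_fin n).symm), Multiset.map_map]
  rfl

theorem eig_eq_of_charpoly_eq {X Y : Sym n}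
    (h : (X : Matrix (Fin n) (Fin n) ℝ).charpoly = (Y : Matrix (Fin n) (Fin n) ℝ).charpoly) :
    eig X = eig Y :=
  eq_of_antitone_of_map_univ_eq (eig_antitone X) (eig_antitone Y)
    (by rw [map_eig_univ, map_eig_univ, h])

/-- The orthogonal conjugate `U X Uᵀ` of a symmetric matrix, as a linear map in `X`. -/
def conj (U : unitaryGroup (Fin n) ℝ) : Sym n →ₗ[ℝ] Sym n where
  toFun X := ⟨U * X * star (U : Matrix (Fin n) (Fin n) ℝ), by
    have hX : star (X : Matrix (Fin n) (Fin n) ℝ) = X := X.2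
    change star _ = _
    simp [mul_assoc, hX]⟩
  map_add' X Y := Subtype.ext <| by simp [mul_add, add_mul]
  map_smul' c X := Subtype.ext <| by simp

@[simp]
theorem coe_conj (U : unitaryGroup (Fin n) ℝ) (X : Sym n) :
    (conj U X : Matrix (Fin n) (Fin n) ℝ) = U * X * star (U : Matrix (Fin n) (Fin n) ℝ) := rfl

/-- The diagonal matrices, as a linear map from `ℝⁿ` to the symmetric matrices. -/
def diag : (Fin n → ℝ) →ₗ[ℝ] Sym n where
  toFun f := ⟨diagonal f, by
    change star _ = _
    simp [star_eq_conjTranspose]⟩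
  map_add' f g := Subtype.ext (diagonal_add f g).symm
  map_smul' c f := Subtype.ext (diagonal_smul c f)

@[simp]
theorem coe_diag (f : Fin n → ℝ) : (diag f : Matrix (Fin n) (Fin n) ℝ) = diagonal f := rfl

theorem conj_conj (U V : unitaryGroup (Fin n) ℝ) (X : Sym n) :
    conj U (conj V X) = conj (U * V) X :=
  Subtype.ext <| by simp [mul_assoc]

@[simp]
theorem conj_star_conj (U : unitaryGroup (Fin n) ℝ) (X : Sym n) :
    conj (star U) (conj U X) = X := by
  rw [conj_conj, Unitary.star_mul_self]
  exact Subtype.ext <| by simp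

theorem charpoly_conj (U : unitaryGroup (Fin n) ℝ) (X : Sym n) :
    (conj U X : Matrix (Fin n) (Fin n) ℝ).charpoly =
      (X : Matrix (Fin n) (Fin n) ℝ).charpoly := by
  rw [coe_conj, charpoly_mul_comm, ← mul_assoc]
  simp

@[simp]
theorem eig_conj (U : unitaryGroup (Fin n) ℝ) (X : Sym n) : eig (conj U X) = eig X :=
  eig_eq_of_charpoly_eq (charpoly_conj U X)

theorem norm_conj (U : unitaryGroup (Fin n) ℝ) (X : Sym n) : ‖conj U X‖ = ‖X‖ := by
  rw [Submodule.coe_norm, Submodule.coe_norm, coe_conj, ← Unitary.coe_star,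
    CStarRing.norm_mul_coe_unitary, CStarRing.norm_coe_unitary_mul]

theorem norm_diag (f : Fin n → ℝ) : ‖diag f‖ = ‖f‖ := l2_opNorm_diagonal f

theorem norm_conj_diag_sub (U : unitaryGroup (Fin n) ℝ) (f g : Fin n → ℝ) :
    ‖conj U (diag f) - conj U (diag g)‖ = ‖f - g‖ := by
  rw [← map_sub, norm_conj, ← map_sub, norm_diag]

/-- Any rearrangement of `f` in nonincreasing order is the eigenvalue vector of `diag f`. -/
theorem eig_diag {f : Fin n → ℝ} {σ : Equiv.Perm (Fin n)} (hσ : Antitone (f ∘ σ)) :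
    eig (diag f) = f ∘ σ := by
  refine eq_of_antitone_of_map_univ_eq (eig_antitone _) hσ ?_
  rw [map_eig_univ, coe_diag, charpoly_diagonal, Polynomial.roots_prod _ _
    (by simp [Finset.prod_ne_zero_iff, Polynomial.X_sub_C_ne_zero]),
    ← Multiset.map_map, Multiset.map_univ_val_equiv]
  simp

theorem exists_antitone_comp_perm (f : Fin n → ℝ) :
    ∃ σ : Equiv.Perm (Fin n), Antitone (f ∘ σ) :=
  ⟨Tuple.sort (-f), fun _ _ h => by simpa using Tuple.monotone_sort (-f) h⟩

theorem exists_perm_eig_conj_diag (U : unitaryGroup (Fin n) ℝ) (f : Fin n → ℝ) :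
    ∃ σ : Equiv.Perm (Fin n), eig (conj U (diag f)) = f ∘ σ := by
  obtain ⟨σ, hσ⟩ := exists_antitone_comp_perm f
  exact ⟨σ, by rw [eig_conj, eig_diag hσ]⟩

/-- The spectral theorem, with the eigenvalues in nonincreasing order. -/
theorem exists_eq_conj_diag_eig (X : Sym n) :
    ∃ U : unitaryGroup (Fin n) ℝ, X = conj U (diag (eig X)) := by
  have hX : IsHermitian (X : Matrix (Fin n) (Fin n) ℝ) := X.2
  obtain ⟨V, f, hV⟩ : ∃ (V : unitaryGroup (Fin n) ℝ) (f : Fin n → ℝ), X = conj V (diag f) :=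
    ⟨hX.eigenvectorUnitary, hX.eigenvalues, Subtype.ext <| by
      have h := hX.spectral_theorem
      rw [Unitary.conjStarAlgAut_apply] at h
      simpa using h⟩
  obtain ⟨σ, hσ⟩ := exists_antitone_comp_perm f
  let P : unitaryGroup (Fin n) ℝ := ⟨(Equiv.Perm.permMatrix ℝ σ)ᵀ, by
    rw [mem_unitaryGroup_iff, star_eq_conjTranspose]
    simp [Equiv.Perm.permMatrix, ← PEquiv.toMatrix_trans, ← PEquiv.toMatrix_symm,
      ← Equiv.toPEquiv_symm, ← Equiv.toPEquiv_trans]⟩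
  have hP : diag f = conj P (diag (f ∘ σ)) := Subtype.ext <| by
    have hσ' : (Equiv.Perm.permMatrix ℝ σ)ᵀ = σ.symm.toPEquiv.toMatrix := by
      rw [Equiv.Perm.permMatrix, ← PEquiv.toMatrix_symm, Equiv.toPEquiv_symm]
    rw [coe_conj, coe_diag, coe_diag, star_eq_conjTranspose,
      conjTranspose_eq_transpose_of_trivial]
    simp only [P, transpose_transpose]
    rw [hσ', PEquiv.toMatrix_toPEquiv_mul, Equiv.Perm.permMatrix, PEquiv.mul_toMatrix_toPEquiv,
      submatrix_submatrix]
    ext i j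
    simp [diagonal_apply]
  refine ⟨V * P, ?_⟩
  rw [← conj_conj]
  conv_rhs => rw [hV, eig_conj, eig_diag hσ, ← hP]
  exact hV

theorem dotProduct_conj_diag (U : unitaryGroup (Fin n) ℝ) (f x : Fin n → ℝ) :
    x ⬝ᵥ (conj U (diag f) : Matrix (Fin n) (Fin n) ℝ) *ᵥ x =
      ∑ j, f j * ((star U : Matrix (Fin n) (Fin n) ℝ) *ᵥ x) j ^ 2 := by
  rw [coe_conj, ← mulVec_mulVec, ← mulVec_mulVec, dotProduct_mulVec, coe_diag]
  have h : x ᵥ* (U : Matrix (Fin n) (Fin n) ℝ) =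
      (star U : Matrix (Fin n) (Fin n) ℝ) *ᵥ x := by
    rw [star_eq_conjTranspose, conjTranspose_eq_transpose_of_trivial, mulVec_transpose]
  rw [h, dotProduct]
  exact Finset.sum_congr rfl fun j _ => by rw [mulVec_diagonal]; ring

theorem dotProduct_self_eq_sum (U : unitaryGroup (Fin n) ℝ) (x : Fin n → ℝ) :
    x ⬝ᵥ x = ∑ j, ((star U : Matrix (Fin n) (Fin n) ℝ) *ᵥ x) j ^ 2 := by
  have h := dotProduct_conj_diag U (fun _ => 1) x
  simpa [diagonal_one] using h

theorem dotProduct_mulVec_le (A : Matrix (Fin n) (Fin n) ℝ) (x : Fin n → ℝ) :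
    x ⬝ᵥ A *ᵥ x ≤ ‖A‖ * (x ⬝ᵥ x) := by
  have h := inner_toEuclideanCLM A (WithLp.toLp 2 x) (WithLp.toLp 2 x)
  simp only at h
  rw [← h]
  have h2 : x ⬝ᵥ x = ‖WithLp.toLp 2 x‖ ^ 2 := by
    rw [EuclideanSpace.norm_sq_eq]; simp [dotProduct, sq]
  rw [h2]
  calc _ ≤ ‖WithLp.toLp 2 x‖ * ‖toEuclideanCLM (𝕜 := ℝ) A (WithLp.toLp 2 x)‖ :=
        real_inner_le_norm _ _
    _ ≤ ‖WithLp.toLp 2 x‖ * (‖A‖ * ‖WithLp.toLp 2 x‖) := by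
        gcongr
        exact (toEuclideanCLM (𝕜 := ℝ) A).le_opNorm _
    _ = _ := by ring

/-- One half of Weyl's inequality. The vector `x` lies in the span of the eigenvectors of `A` for
`λ₁(A), …, λᵢ(A)` and in that of the eigenvectors of `B` for `λᵢ(B), …, λₙ(B)`: these are `n - 1`
linear equations, so a nonzero solution exists. -/
theorem eig_le_eig_add_norm (A B : Sym n) (i : Fin n) : eig A i ≤ eig B i + ‖A - B‖ := by
  obtain ⟨U, hU⟩ := exists_eq_conj_diag_eig A
  obtain ⟨V, hV⟩ := exists_eq_conj_diag_eig B
  let N : Matrix (Fin n) (Fin n) ℝ := of fun j k =>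
    if i < j then (star U : Matrix (Fin n) (Fin n) ℝ) j k
    else if j < i then (star V : Matrix (Fin n) (Fin n) ℝ) j k else 0
  obtain ⟨x, hx0, hx⟩ := exists_mulVec_eq_zero_iff.2
    (det_eq_zero_of_row_eq_zero (A := N) i fun k => by simp [N])
  have hxU : ∀ j, i < j → ((star U : Matrix (Fin n) (Fin n) ℝ) *ᵥ x) j = 0 := fun j hj => by
    simpa [N, hj, mulVec, dotProduct] using congrFun hx j
  have hxV : ∀ j, j < i → ((star V : Matrix (Fin n) (Fin n) ℝ) *ᵥ x) j = 0 := fun j hj => by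
    simpa [N, hj, hj.not_gt, mulVec, dotProduct] using congrFun hx j
  have hpos : 0 < x ⬝ᵥ x :=
    lt_of_le_of_ne (Finset.sum_nonneg fun j _ => mul_self_nonneg _)
      (fun h => hx0 (dotProduct_self_eq_zero.1 h.symm))
  have h1 : eig A i * (x ⬝ᵥ x) ≤ x ⬝ᵥ (A : Matrix (Fin n) (Fin n) ℝ) *ᵥ x := by
    conv_rhs => rw [hU]
    rw [dotProduct_conj_diag, dotProduct_self_eq_sum U, Finset.mul_sum]
    refine Finset.sum_le_sum fun j _ => ?_
    rcases lt_or_ge i j with h | h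
    · simp [hxU j h]
    · exact mul_le_mul_of_nonneg_right (eig_antitone A h) (sq_nonneg _)
  have h2 : x ⬝ᵥ (B : Matrix (Fin n) (Fin n) ℝ) *ᵥ x ≤ eig B i * (x ⬝ᵥ x) := by
    conv_lhs => rw [hV]
    rw [dotProduct_conj_diag, dotProduct_self_eq_sum V, Finset.mul_sum]
    refine Finset.sum_le_sum fun j _ => ?_
    rcases lt_or_ge j i with h | h
    · simp [hxV j h]
    · exact mul_le_mul_of_nonneg_right (eig_antitone B h) (sq_nonneg _)
  have h3 := dotProduct_mulVec_le ((A - B : Sym n) : Matrix (Fin n) (Fin n) ℝ) x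
  rw [Submodule.coe_sub, sub_mulVec, dotProduct_sub, ← Submodule.coe_sub,
    ← Submodule.coe_norm] at h3
  exact le_of_mul_le_mul_right (by linarith) hpos

/-- **Weyl's inequality**: the eigenvalue map is nonexpansive for the operator norm on matrices
and the supremum norm on `ℝⁿ`. -/
theorem norm_eig_sub_le (A B : Sym n) : ‖eig A - eig B‖ ≤ ‖A - B‖ := by
  refine (pi_norm_le_iff_of_nonneg (norm_nonneg _)).2 fun i => abs_sub_le_iff.2 ⟨?_, ?_⟩
  · linarith [eig_le_eig_add_norm A B i]
  · have := eig_le_eig_add_norm B A i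
    rw [norm_sub_rev] at this
    linarith

end Eigenvalues

/-! ### Simultaneous diagonalization -/

section SimultaneousDiagonalization

open Matrix Module.End

variable {n : ℕ}

set_option maxHeartbeats 1000000 in
/-- Commuting symmetric matrices can be diagonalized in the same orthonormal basis. -/
theorem exists_forall_eq_conj_diag {ι : Type*} [Finite ι] (A : ι → Sym n)
    (hA : ∀ k l, Commute (A k : Matrix (Fin n) (Fin n) ℝ) (A l)) :
    ∃ (U : unitaryGroup (Fin n) ℝ) (f : ι → Fin n → ℝ), ∀ k, A k = conj U (diag (f k)) := by
  classical
  let T : ι → EuclideanSpace ℝ (Fin n) →ₗ[ℝ] EuclideanSpace ℝ (Fin n) := fun k =>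
    toEuclideanLin (A k : Matrix (Fin n) (Fin n) ℝ)
  have hT : ∀ k, (T k).IsSymmetric := fun k => isSymmetric_toEuclideanLin_iff.2 (A k).2
  have hTc : Pairwise (Function.onFun Commute T) := fun k l _ => by
    refine LinearMap.ext fun v => ?_
    simp only [T, Module.End.mul_apply, toLpLin_apply, mulVec_mulVec, (hA k l).eq]
  let E : (ι → ℝ) → Submodule ℝ (EuclideanSpace ℝ (Fin n)) := fun α => ⨅ j, eigenspace (T j) (α j)
  have hE : DirectSum.IsInternal E :=
    LinearMap.IsSymmetric.directSum_isInternal_of_pairwise_commute hT hTc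
  have hEo : OrthogonalFamily ℝ (fun α => E α) fun α => (E α).subtypeₗᵢ :=
    LinearMap.IsSymmetric.orthogonalFamily_iInf_eigenspaces hT
  -- the set of joint eigenvalues is finite, so the joint eigenspaces have an orthonormal basis
  have hfin : Finite {α // E α ≠ ⊥} :=
    (WellFoundedGT.finite_ne_bot_of_iSupIndep hE.submodule_iSupIndep).to_subtype
  have := Fintype.ofFinite {α // E α ≠ ⊥}
  have hE' : DirectSum.IsInternal fun α : {α // E α ≠ ⊥} => E α :=
    DirectSum.isInternal_ne_bot_iff.2 hE
  have hEo' := hEo.comp (Subtype.val_injective (p := fun α => E α ≠ ⊥))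
  let b := hE'.subordinateOrthonormalBasis finrank_euclideanSpace_fin hEo'
  let c := fun i => (hE'.subordinateOrthonormalBasisIndex finrank_euclideanSpace_fin i hEo').1
  have hb : ∀ k i, T k (b i) = c i k • b i := fun k i => by
    have := hE'.subordinateOrthonormalBasis_subordinate finrank_euclideanSpace_fin i hEo'
    exact mem_eigenspace_iff.1 ((Submodule.mem_iInf _).1 this k)
  let U : unitaryGroup (Fin n) ℝ := ⟨(EuclideanSpace.basisFun (Fin n) ℝ).toBasis.toMatrix b,
    (EuclideanSpace.basisFun (Fin n) ℝ).toMatrix_orthonormalBasis_mem_unitary b⟩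
  refine ⟨U, fun k i => c i k, fun k => Subtype.ext ?_⟩
  have h : (A k : Matrix (Fin n) (Fin n) ℝ) * U = U * diagonal fun i => c i k := by
    ext i j
    have := congrArg (fun v : EuclideanSpace ℝ (Fin n) => v i) (hb k j)
    simp only [T, toLpLin_apply] at this
    rw [mul_diagonal]
    simpa [U, Matrix.mul_apply, mulVec, dotProduct, Module.Basis.toMatrix_apply, mul_comm] using this
  rw [coe_conj, coe_diag, ← h, mul_assoc]
  simp

end SimultaneousDiagonalization

/-! ### Second-order expansion of the eigenvalues -/

section Expansion

open Matrix Asymptotics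
open scoped Matrix.Norms.L2Operator

variable {n : ℕ}

/-- If `T` is skew-symmetric, then `U = (1 + T)(1 - T)⁻¹` is orthogonal (the Cayley transform), and
`Uᵀ Y U - A` is `(1 + T)⁻¹ ((1 - T) Y (1 + T) - (1 + T) A (1 - T)) (1 - T)⁻¹`. -/
theorem norm_eig_sub_le_of_skew (Y A : Sym n) {T : Matrix (Fin n) (Fin n) ℝ} (hT : star T = -T)
    (hT' : ‖T‖ ≤ 1 / 2) :
    ‖eig Y - eig A‖ ≤ 4 * ‖(1 - T) * (Y : Matrix (Fin n) (Fin n) ℝ) * (1 + T) -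
      (1 + T) * (A : Matrix (Fin n) (Fin n) ℝ) * (1 - T)‖ := by
  obtain ⟨S, hS1⟩ : ∃ S, (1 - T) * S = 1 := ⟨_, (Units.oneSub T (by linarith)).mul_inv⟩
  have hS3 : star S * (1 + T) = 1 := by
    have := congrArg star hS1
    rwa [star_mul, star_sub, hT, star_one, sub_neg_eq_add] at this
  have hone : ‖(1 : Matrix (Fin n) (Fin n) ℝ)‖ ≤ 1 := by
    rw [← diagonal_one, l2_opNorm_diagonal]
    exact (pi_norm_le_iff_of_nonneg zero_le_one).2 fun i => by simp
  have hSn : ‖S‖ ≤ 2 := by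
    have h1 : S = 1 + T * S := by rw [sub_mul, one_mul] at hS1; rw [← hS1]; abel
    have h2 : ‖S‖ ≤ 1 + 1 / 2 * ‖S‖ := calc
      ‖S‖ = ‖1 + T * S‖ := by rw [← h1]
      _ ≤ ‖(1 : Matrix (Fin n) (Fin n) ℝ)‖ + ‖T‖ * ‖S‖ :=
        (norm_add_le _ _).trans (by gcongr; exact norm_mul_le _ _)
      _ ≤ _ := by gcongr
    linarith
  have hcomm : (1 - T) * (1 + T) = (1 + T) * (1 - T) := by noncomm_ring
  let U : unitaryGroup (Fin n) ℝ := ⟨(1 + T) * S, by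
    rw [mem_unitaryGroup_iff', star_mul, star_add, hT, star_one, ← sub_eq_add_neg]
    calc star S * (1 - T) * ((1 + T) * S) = star S * ((1 - T) * (1 + T)) * S := by noncomm_ring
      _ = (star S * (1 + T)) * ((1 - T) * S) := by rw [hcomm]; noncomm_ring
      _ = 1 := by rw [hS3, hS1, one_mul]⟩
  rw [← eig_conj (star U) Y]
  refine (norm_eig_sub_le _ _).trans ?_
  have key : ((conj (star U) Y - A : Sym n) : Matrix (Fin n) (Fin n) ℝ) =
      star S * ((1 - T) * (Y : Matrix (Fin n) (Fin n) ℝ) * (1 + T) -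
      (1 + T) * (A : Matrix (Fin n) (Fin n) ℝ) * (1 - T)) * S := by
    have hU : star ((1 + T) * S) = star S * (1 - T) := by
      rw [star_mul, star_add, hT, star_one, ← sub_eq_add_neg]
    rw [Submodule.coe_sub, coe_conj, Unitary.coe_star, star_star]
    simp only [U, hU]
    calc _ = star S * (1 - T) * Y * ((1 + T) * S) -
        (star S * (1 + T)) * A * ((1 - T) * S) := by rw [hS3, hS1, one_mul, mul_one]
      _ = _ := by noncomm_ring
  rw [Submodule.coe_norm, key]
  calc _ ≤ ‖star S‖ * _ * ‖S‖ := (norm_mul_le _ _).trans (by gcongr; exact norm_mul_le _ _)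
    _ ≤ 2 * ‖(1 - T) * (Y : Matrix (Fin n) (Fin n) ℝ) * (1 + T) -
      (1 + T) * (A : Matrix (Fin n) (Fin n) ℝ) * (1 - T)‖ * 2 := by rw [norm_star]; gcongr
    _ = _ := by ring

/-- The eigenvalues of `X + tH + t²G` have an expansion `x + td + t²g + O(t³)` as `t ↓ 0`. -/
def HasExpansion (X H G : Sym n) : Prop :=
  ∃ x d g : Fin n → ℝ, (fun t : ℝ => eig (X + t • H + t ^ 2 • G) - (x + t • d + t ^ 2 • g))
    =O[𝓝[>] 0] fun t => t ^ 3

theorem HasExpansion.of_conj {X H G : Sym n} (U : unitaryGroup (Fin n) ℝ)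
    (h : HasExpansion (conj U X) (conj U H) (conj U G)) : HasExpansion X H G := by
  obtain ⟨x, d, g, h⟩ := h
  refine ⟨x, d, g, h.congr_left fun t => ?_⟩
  rw [← map_smul, ← map_smul, ← map_add, ← map_add, eig_conj]

/-- Conjugating `X + tH + t²G` with the Cayley transform of `-(tK + t²L)` changes `H` by `2[X, K]`
and `G` by `[2H + 2[X, K], K] + 2[X, L]`, up to an error of third order. -/
theorem HasExpansion.of_skew {X H G H' G' : Sym n} {K L : Matrix (Fin n) (Fin n) ℝ}
    (hK : star K = -K) (hL : star L = -L)
    (hH : (H' : Matrix (Fin n) (Fin n) ℝ) = H + (2 : ℝ) • (X * K - K * X))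
    (hG : (G' : Matrix (Fin n) (Fin n) ℝ) = G + ((H + H') * K - K * (H + H')) +
      (2 : ℝ) • (X * L - L * X))
    (h : HasExpansion X H' G') : HasExpansion X H G := by
  obtain ⟨x, d, g, h⟩ := h
  refine ⟨x, d, g, ?_⟩
  have key : (fun t : ℝ => eig (X + t • H + t ^ 2 • G) - eig (X + t • H' + t ^ 2 • G'))
      =O[𝓝[>] 0] fun t => t ^ 3 := by
    let F : ℝ → Matrix (Fin n) (Fin n) ℝ := fun t =>
      ((H + H') * L - L * (H + H')) + ((G + G') * K - K * (G + G')) +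
        t • ((G + G') * L - L * (G + G')) -
        (K + t • L) * (H - H' + t • (G - G')) * (K + t • L)
    have hF : ContinuousAt F 0 := by fun_prop
    have hT : Tendsto (fun t : ℝ => ‖t • K + t ^ 2 • L‖) (𝓝[>] 0) (𝓝 0) := by
      have : Continuous fun t : ℝ => ‖t • K + t ^ 2 • L‖ := by fun_prop
      simpa using (this.tendsto 0).mono_left nhdsWithin_le_nhds
    have h1 : (fun t : ℝ => t ^ 3 • F t) =O[𝓝[>] 0] fun t => t ^ 3 := by
      have : F =O[𝓝[>] 0] fun _ => (1 : ℝ) :=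
        (hF.tendsto.isBigO_one ℝ).mono nhdsWithin_le_nhds
      simpa using (isBigO_refl (fun t : ℝ => t ^ 3) (𝓝[>] 0)).smul this
    refine IsBigO.trans (IsBigO.of_bound 4 ?_) h1
    filter_upwards [hT.eventually_le_const (show (0 : ℝ) < 1 / 2 by norm_num)] with t ht
    refine (norm_eig_sub_le_of_skew _ _ (T := t • K + t ^ 2 • L) ?_ ht).trans_eq ?_
    · simp only [star_add, star_smul, hK, hL, star_trivial]
      module
    · congr 2
      simp only [F, Submodule.coe_add, Submodule.coe_smul, hG, hH]
      simp only [mul_add, add_mul, mul_sub, sub_mul, smul_mul_assoc, mul_smul_comm, smul_add,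
        smul_sub, mul_one, one_mul, mul_assoc]
      module
  refine (key.add h).congr_left fun t => ?_
  abel

theorem eventually_nonneg_or_eventually_neg (a b c : ℝ) :
    (∀ᶠ t in 𝓝[>] (0 : ℝ), 0 ≤ a + t * b + t ^ 2 * c) ∨
      ∀ᶠ t in 𝓝[>] (0 : ℝ), a + t * b + t ^ 2 * c < 0 := by
  have pos : ∀ a b c : ℝ, 0 < a → ∀ᶠ t in 𝓝[>] (0 : ℝ), 0 < a + t * b + t ^ 2 * c := by
    intro a b c ha
    have h : Continuous fun t : ℝ => a + t * b + t ^ 2 * c := by fun_prop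
    exact ((h.tendsto 0).mono_left nhdsWithin_le_nhds).eventually_const_lt (by simpa using ha)
  have hpos : ∀ᶠ t in 𝓝[>] (0 : ℝ), 0 < t := self_mem_nhdsWithin
  rcases lt_trichotomy a 0 with ha | rfl | ha
  · right
    filter_upwards [pos (-a) (-b) (-c) (by linarith)] with t ht
    linarith
  · rcases lt_trichotomy b 0 with hb | rfl | hb
    · right
      filter_upwards [pos (-b) (-c) 0 (by linarith), hpos] with t ht ht0
      nlinarith
    · rcases le_or_gt 0 c with hc | hc
      · exact Or.inl (Eventually.of_forall fun t => by nlinarith [mul_nonneg (sq_nonneg t) hc])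
      · right
        filter_upwards [hpos] with t ht0
        nlinarith [mul_pos (pow_pos ht0 2) (neg_pos.2 hc)]
    · left
      filter_upwards [pos b c 0 hb, hpos] with t ht ht0
      nlinarith
  · left
    filter_upwards [pos a b c ha] with t ht
    exact ht.le

/-- For small `t > 0` the entries of `x + td + t²g` are in an order that does not depend on `t`
(the lexicographic order of the triples `(xᵢ, dᵢ, gᵢ)`). -/
theorem exists_perm_eventually_antitone (x d g : Fin n → ℝ) :
    ∃ σ : Equiv.Perm (Fin n), ∀ᶠ t in 𝓝[>] (0 : ℝ), Antitone ((x + t • d + t ^ 2 • g) ∘ σ) := by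
  let f : ℝ → Fin n → ℝ := fun t => x + t • d + t ^ 2 • g
  have h : ∀ᶠ s in 𝓝[>] (0 : ℝ), ∀ i j, f s i ≤ f s j → ∀ᶠ t in 𝓝[>] (0 : ℝ), f t i ≤ f t j := by
    simp only [eventually_all]
    intro i j
    rcases eventually_nonneg_or_eventually_neg (x j - x i) (d j - d i) (g j - g i) with h | h
    · refine Eventually.of_forall fun s _ => ?_
      filter_upwards [h] with t ht
      simp only [f, Pi.add_apply, Pi.smul_apply, smul_eq_mul]
      linarith
    · filter_upwards [h] with s hs hs'
      simp only [f, Pi.add_apply, Pi.smul_apply, smul_eq_mul] at hs'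
      linarith
  obtain ⟨s, hs⟩ := h.exists
  obtain ⟨σ, hσ⟩ := exists_antitone_comp_perm (f s)
  refine ⟨σ, ?_⟩
  have h' : ∀ᶠ t in 𝓝[>] (0 : ℝ), ∀ i j, i ≤ j → f t (σ j) ≤ f t (σ i) := by
    simp only [eventually_all]
    exact fun i j hij => hs _ _ (hσ hij)
  filter_upwards [h'] with t ht i j hij
  exact ht i j hij

theorem hasExpansion_diag (x d g : Fin n → ℝ) : HasExpansion (diag x) (diag d) (diag g) := by
  obtain ⟨σ, hσ⟩ := exists_perm_eventually_antitone x d g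
  refine ⟨x ∘ σ, d ∘ σ, g ∘ σ, (isBigO_zero _ _).congr' ?_ EventuallyEq.rfl⟩
  filter_upwards [hσ] with t ht
  rw [← map_smul, ← map_smul, ← map_add, ← map_add, eig_diag ht]
  exact (sub_self _).symm

theorem commute_diagonal_iff {x : Fin n → ℝ} {A : Matrix (Fin n) (Fin n) ℝ} :
    Commute (diagonal x) A ↔ ∀ i j, x i ≠ x j → A i j = 0 := by
  constructor
  · intro h i j hij
    have := congrFun (congrFun h.eq i) j
    rw [diagonal_mul, mul_diagonal] at this
    exact (mul_eq_zero.1 (show (x i - x j) * A i j = 0 by linarith)).resolve_left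
      (sub_ne_zero.2 hij)
  · intro h
    refine Matrix.ext fun i j => ?_
    rw [diagonal_mul, mul_diagonal]
    by_cases hij : x i = x j
    · rw [hij, mul_comm]
    · rw [h i j hij, mul_zero, zero_mul]

/-- The solution `K` of `A + 2[diag x, K] = 0` off the diagonal blocks of `diag x`. Within these
blocks `K` vanishes, by the convention `a / 0 = 0`. -/
noncomputable def skewSolution (x : Fin n → ℝ) (A : Matrix (Fin n) (Fin n) ℝ) :
    Matrix (Fin n) (Fin n) ℝ :=
  of fun i j => A i j / (2 * (x j - x i))

theorem star_skewSolution (x : Fin n → ℝ) {A : Matrix (Fin n) (Fin n) ℝ} (hA : star A = A) :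
    star (skewSolution x A) = -skewSolution x A := by
  ext i j
  have h : A j i = A i j := congrFun (congrFun hA i) j
  change A j i / (2 * (x i - x j)) = -(A i j / (2 * (x j - x i)))
  rw [h, ← div_neg]
  congr 1
  ring

theorem bracket_skewSolution_apply (x : Fin n → ℝ) (A : Matrix (Fin n) (Fin n) ℝ) (i j : Fin n) :
    ((2 : ℝ) • (diagonal x * skewSolution x A - skewSolution x A * diagonal x)) i j =
      if x i = x j then 0 else -A i j := by
  rw [Matrix.smul_apply, Matrix.sub_apply, diagonal_mul, mul_diagonal, skewSolution, of_apply, smul_eq_mul]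
  split_ifs with h
  · rw [h]; ring
  · have : x j - x i ≠ 0 := sub_ne_zero.2 (Ne.symm h)
    field_simp
    ring

/-- The commutator of a symmetric and a skew-symmetric matrix is symmetric. -/
theorem star_bracket {A K : Matrix (Fin n) (Fin n) ℝ} (hA : star A = A) (hK : star K = -K) :
    star (A * K - K * A) = A * K - K * A := by
  rw [star_sub, star_mul, star_mul, hA, hK]
  noncomm_ring

theorem commute_coe_diag (x y : Fin n → ℝ) :
    Commute (diag x : Matrix (Fin n) (Fin n) ℝ) (diag y) :=
  (commute_diagonal_iff).2 fun _ _ hij => diagonal_apply_ne _ fun h => hij (h ▸ rfl)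

/-- If `X` and `H` are diagonal, then `G` can be made to commute with both: `L` removes its entries
outside the diagonal blocks of `X`, and `K`, which commutes with `X`, those inside these blocks but
outside the blocks of `H`. -/
theorem hasExpansion_diag_diag (x d : Fin n → ℝ) (G : Sym n) :
    HasExpansion (diag x) (diag d) G := by
  let G₀ : Matrix (Fin n) (Fin n) ℝ := G
  have hG₀ : star G₀ = G₀ := G.2
  have hd : star (diagonal d) = diagonal d := (diag d).2
  have hx : star (diagonal x) = diagonal x := (diag x).2
  -- the part of `G₀` inside the diagonal blocks of `diag x`
  let B : Matrix (Fin n) (Fin n) ℝ := of fun i j => if x i = x j then G₀ i j else 0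
  have hB : star B = B := by
    ext i j
    change (if x j = x i then G₀ j i else 0) = if x i = x j then G₀ i j else 0
    rw [show G₀ j i = G₀ i j from congrFun (congrFun hG₀ i) j]
    simp only [eq_comm]
  let L := skewSolution x G₀
  let K := skewSolution d B
  have hL : star L = -L := star_skewSolution x hG₀
  have hK : star K = -K := star_skewSolution d hB
  have hxK : Commute (diagonal x) K := commute_diagonal_iff.2 fun i j hij => by
    simp [K, skewSolution, B, hij]
  have hstar : ∀ {A T : Matrix (Fin n) (Fin n) ℝ}, star A = A → star T = -T →
      star ((2 : ℝ) • (A * T - T * A)) = (2 : ℝ) • (A * T - T * A) := fun hA hT => by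
    rw [star_smul, star_bracket hA hT, star_trivial]
  let G' : Sym n := ⟨G₀ + (2 : ℝ) • (diagonal d * K - K * diagonal d) +
    (2 : ℝ) • (diagonal x * L - L * diagonal x), by
      change star _ = _
      rw [star_add, star_add, hG₀, hstar hd hK, hstar hx hL]⟩
  have hG' : ∀ i j, (G' : Matrix (Fin n) (Fin n) ℝ) i j =
      if x i = x j ∧ d i = d j then G₀ i j else 0 := fun i j => by
    change G₀ i j + ((2 : ℝ) • (diagonal d * K - K * diagonal d)) i j +
      ((2 : ℝ) • (diagonal x * L - L * diagonal x)) i j = _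
    rw [bracket_skewSolution_apply, bracket_skewSolution_apply]
    by_cases h1 : x i = x j <;> by_cases h2 : d i = d j <;> simp [h1, h2, B]
  have hxG : Commute (diag x : Matrix (Fin n) (Fin n) ℝ) (G' : Matrix (Fin n) (Fin n) ℝ) :=
    commute_diagonal_iff.2 fun i j hij => by simp [hG', hij]
  have hdG : Commute (diag d : Matrix (Fin n) (Fin n) ℝ) (G' : Matrix (Fin n) (Fin n) ℝ) :=
    commute_diagonal_iff.2 fun i j hij => by simp [hG', hij]
  refine HasExpansion.of_skew hK hL (H' := diag d) (G' := G') ?_ ?_ ?_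
  · rw [coe_diag x, hxK.eq, sub_self, smul_zero, add_zero]
  · change G₀ + _ + _ = G₀ + _ + _
    rw [coe_diag d, coe_diag x, add_mul, mul_add]
    module
  · obtain ⟨U, f, hf⟩ := exists_forall_eq_conj_diag ![diag x, diag d, G'] (by
      intro k l
      fin_cases k <;> fin_cases l <;>
        simp [commute_coe_diag, hxG, hdG, hxG.symm, hdG.symm, -coe_diag])
    refine HasExpansion.of_conj (star U) ?_
    have h0 : diag x = conj U (diag (f 0)) := hf 0
    have h1 : diag d = conj U (diag (f 1)) := hf 1
    have h2 : G' = conj U (diag (f 2)) := hf 2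
    rw [h0, h1, h2, conj_star_conj, conj_star_conj, conj_star_conj]
    exact hasExpansion_diag _ _ _

theorem hasExpansion (X H G : Sym n) : HasExpansion X H G := by
  have hdiag : ∀ (x : Fin n → ℝ) (H G : Sym n), HasExpansion (diag x) H G := by
    intro x H G
    let H₀ : Matrix (Fin n) (Fin n) ℝ := H
    have hH₀ : star H₀ = H₀ := H.2
    have hG₀ : star (G : Matrix (Fin n) (Fin n) ℝ) = G := G.2
    have hx : star (diagonal x) = diagonal x := (diag x).2
    let K := skewSolution x H₀
    have hK : star K = -K := star_skewSolution x hH₀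
    let H' : Sym n := ⟨H₀ + (2 : ℝ) • (diagonal x * K - K * diagonal x), by
      change star _ = _
      rw [star_add, hH₀, star_smul, star_bracket hx hK, star_trivial]⟩
    have hH' : star (H' : Matrix (Fin n) (Fin n) ℝ) = H' := H'.2
    have hxH : Commute (diag x : Matrix (Fin n) (Fin n) ℝ) (H' : Matrix (Fin n) (Fin n) ℝ) :=
      commute_diagonal_iff.2 fun i j hij => by
        change H₀ i j + ((2 : ℝ) • (diagonal x * K - K * diagonal x)) i j = 0
        rw [bracket_skewSolution_apply, if_neg hij, add_neg_cancel]
    let G' : Sym n := ⟨G + ((H₀ + H') * K - K * (H₀ + H')), by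
      change star _ = _
      rw [star_add, hG₀, star_bracket (by rw [star_add, hH₀, hH']) hK]⟩
    refine HasExpansion.of_skew (L := 0) (H' := H') (G' := G') hK (by simp) rfl (by simp [G', H₀]) ?_
    obtain ⟨U, f, hf⟩ := exists_forall_eq_conj_diag ![diag x, H'] (by
      intro k l
      fin_cases k <;> fin_cases l <;>
        simp [hxH, hxH.symm, -coe_diag])
    refine HasExpansion.of_conj (star U) ?_
    have h0 : diag x = conj U (diag (f 0)) := hf 0
    have h1 : H' = conj U (diag (f 1)) := hf 1
    rw [h0, h1, conj_star_conj, conj_star_conj]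
    exact hasExpansion_diag_diag _ _ _
  obtain ⟨U, hU⟩ := exists_eq_conj_diag_eig X
  refine HasExpansion.of_conj (star U) ?_
  have : conj (star U) X = diag (eig X) := by
    conv_lhs => rw [hU, conj_star_conj]
  rw [this]
  exact hdiag _ _ _

end Expansion

/-! ### Directional derivatives of the eigenvalues -/

section Derivatives

open Asymptotics
open scoped Matrix.Norms.L2Operator

variable {n : ℕ}

theorem continuous_eig : Continuous (eig : Sym n → Fin n → ℝ) :=
  LipschitzWith.continuous (K := 1) <| LipschitzWith.of_dist_le_mul fun A B => by
    simpa [dist_eq_norm] using norm_eig_sub_le A B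

theorem isLittleO_pow_pow_nhdsGT {k l : ℕ} (h : k < l) :
    (fun t : ℝ => t ^ l) =o[𝓝[>] 0] fun t => t ^ k :=
  (isLittleO_pow_pow h).mono nhdsWithin_le_nhds

/-- The first-order coefficient of the expansion of `λ(X + tH + t²G)` does not depend on `G`. -/
theorem exists_expansion (X H : Sym n) :
    ∃ d : Fin n → ℝ, ∀ G : Sym n, ∃ g : Fin n → ℝ,
      (fun t : ℝ => eig (X + t • H + t ^ 2 • G) - (eig X + t • d + t ^ 2 • g))
        =O[𝓝[>] 0] fun t => t ^ 3 := by
  have aux : ∀ G : Sym n, ∃ d g : Fin n → ℝ,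
      (fun t : ℝ => eig (X + t • H + t ^ 2 • G) - (eig X + t • d + t ^ 2 • g))
        =O[𝓝[>] 0] fun t => t ^ 3 := by
    intro G
    obtain ⟨x, d, g, h⟩ := hasExpansion X H G
    suffices hx : eig X = x from ⟨d, g, by rwa [hx]⟩
    have h0 : Tendsto (fun t : ℝ => eig (X + t • H + t ^ 2 • G) - (x + t • d + t ^ 2 • g))
        (𝓝[>] 0) (𝓝 0) :=
      (isLittleO_one_iff ℝ).1 (h.trans_isLittleO
        (by simpa using isLittleO_pow_pow_nhdsGT (k := 0) (l := 3) (by norm_num)))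
    have h1 : Continuous fun t : ℝ =>
        eig (X + t • H + t ^ 2 • G) - (x + t • d + t ^ 2 • g) :=
      (continuous_eig.comp (by fun_prop)).sub (by fun_prop)
    have h2 := tendsto_nhds_unique h0 ((h1.tendsto 0).mono_left nhdsWithin_le_nhds)
    simp only [zero_smul, add_zero, ne_eq, OfNat.ofNat_ne_zero, not_false_eq_true, zero_pow] at h2
    exact (sub_eq_zero.1 h2.symm)
  obtain ⟨d, g₀, h₀⟩ := aux 0
  refine ⟨d, fun G => ?_⟩
  obtain ⟨d', g, h⟩ := aux G
  suffices hd : d = d' from ⟨g, by rwa [hd]⟩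
  -- by Weyl's inequality the two eigenvalue curves differ by `O(t²)`
  have hW : (fun t : ℝ => eig (X + t • H + t ^ 2 • G) - eig (X + t • H + t ^ 2 • (0 : Sym n)))
      =O[𝓝[>] 0] fun t => t ^ 2 := by
    refine IsBigO.of_bound ‖G‖ (Eventually.of_forall fun t => ?_)
    refine (norm_eig_sub_le _ _).trans_eq ?_
    rw [smul_zero, add_zero, add_sub_cancel_left, norm_smul, mul_comm]
  have h32 : (fun t : ℝ => t ^ 3) =O[𝓝[>] 0] fun t : ℝ => t ^ 2 :=
    (isLittleO_pow_pow_nhdsGT (by norm_num)).isBigO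
  have hg : (fun t : ℝ => t ^ 2 • (g₀ - g)) =O[𝓝[>] 0] fun t => t ^ 2 := by
    simpa using (isBigO_refl (fun t : ℝ => t ^ 2) (𝓝[>] 0)).smul
      (isBigO_const_const (g₀ - g) (one_ne_zero (α := ℝ)) (𝓝[>] 0))
  have h1 : (fun t : ℝ => t • (d' - d)) =o[𝓝[>] 0] fun t => t ^ 1 := by
    refine IsBigO.trans_isLittleO ?_ (isLittleO_pow_pow_nhdsGT (k := 1) (l := 2) (by norm_num))
    refine (((h₀.trans h32).sub (h.trans h32)).add (hW.add hg)).congr_left fun t => ?_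
    module
  have h2 : Tendsto (fun t : ℝ => (t ^ 1)⁻¹ • t • (d' - d)) (𝓝[>] 0) (𝓝 0) :=
    h1.tendsto_inv_smul_nhds_zero
  have h3 : Tendsto (fun _ : ℝ => d' - d) (𝓝[>] 0) (𝓝 0) := by
    refine h2.congr' ?_
    filter_upwards [self_mem_nhdsWithin] with t (ht : 0 < t)
    rw [pow_one, inv_smul_smul₀ ht.ne']
  exact (sub_eq_zero.1 (tendsto_nhds_unique tendsto_const_nhds h3)).symm

theorem tendsto_eigQuot_and_quot2 (X H : Sym n) :
    (∀ i, Tendsto (eigQuot X H i) (𝓝[>] 0) (𝓝 (eigDeriv X H i))) ∧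
      ∀ W, ∃ g, Tendsto (fun t : ℝ => (1 / 2 * t ^ 2)⁻¹ •
        (eig (X + t • H + (1 / 2 * t ^ 2) • W) - eig X - t • eigDeriv X H)) (𝓝[>] 0) (𝓝 g) := by
  obtain ⟨d, hd⟩ := exists_expansion X H
  have h1 : ∀ i, Tendsto (eigQuot X H i) (𝓝[>] 0) (𝓝 (d i)) := by
    obtain ⟨g, hg⟩ := hd 0
    have h := (hg.trans_isLittleO (isLittleO_pow_pow_nhdsGT
      (k := 1) (by norm_num))).tendsto_inv_smul_nhds_zero
    have h' : Tendsto (fun t : ℝ => d + t • g) (𝓝[>] 0) (𝓝 (d + (0 : ℝ) • g)) :=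
      (Continuous.tendsto (by fun_prop) 0).mono_left nhdsWithin_le_nhds
    intro i
    have h2 := tendsto_pi_nhds.1 (h.add h') i
    rw [zero_smul, zero_add, add_zero] at h2
    refine h2.congr' ?_
    filter_upwards [self_mem_nhdsWithin] with t (ht : 0 < t)
    simp only [smul_zero, add_zero, eigQuot, Pi.add_apply, Pi.smul_apply, Pi.sub_apply,
      smul_eq_mul]
    field_simp
    ring
  have hd' : eigDeriv X H = d := funext fun i => (h1 i).limUnder_eq
  refine ⟨fun i => hd' ▸ h1 i, fun W => ?_⟩
  obtain ⟨g, hg⟩ := hd ((1 / 2 : ℝ) • W)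
  have h := (hg.trans_isLittleO (isLittleO_pow_pow_nhdsGT
    (k := 2) (by norm_num))).tendsto_inv_smul_nhds_zero
  refine ⟨(2 : ℝ) • ((0 : Fin n → ℝ) + g), ((h.add_const g).const_smul (2 : ℝ)).congr' ?_⟩
  filter_upwards [self_mem_nhdsWithin] with t (ht : 0 < t)
  have ht' : t ^ 2 ≠ 0 := by positivity
  rw [hd', smul_smul, mul_comm (t ^ 2) (1 / 2 : ℝ)]
  conv_lhs => rw [← inv_smul_smul₀ ht' g, ← smul_add, smul_smul, inv_smul_smul₀ ht']
  congr 1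
  · rw [mul_inv, one_div, inv_inv]
  · abel

theorem tendsto_eigQuot (X H : Sym n) (i : Fin n) :
    Tendsto (eigQuot X H i) (𝓝[>] 0) (𝓝 (eigDeriv X H i)) :=
  (tendsto_eigQuot_and_quot2 X H).1 i

theorem tendsto_quot2 (X H W : Sym n) :
    Tendsto (fun t : ℝ => (1 / 2 * t ^ 2)⁻¹ •
      (eig (X + t • H + (1 / 2 * t ^ 2) • W) - eig X - t • eigDeriv X H))
      (𝓝[>] 0) (𝓝 (eigDeriv2 X H W)) := by
  obtain ⟨g, hg⟩ := (tendsto_eigQuot_and_quot2 X H).2 W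
  have h : ∀ i, Tendsto (eigQuot2 X H W i) (𝓝[>] 0) (𝓝 (g i)) := fun i =>
    (tendsto_pi_nhds.1 hg i).congr fun t => by
      simp [eigQuot2, div_eq_inv_mul]
  rwa [show eigDeriv2 X H W = g from funext fun i => (h i).limUnder_eq]

theorem tendsto_eigQuot2 (X H W : Sym n) (i : Fin n) :
    Tendsto (eigQuot2 X H W i) (𝓝[>] 0) (𝓝 (eigDeriv2 X H W i)) :=
  (tendsto_pi_nhds.1 (tendsto_quot2 X H W) i).congr fun t => by
    simp [eigQuot2, div_eq_inv_mul]

end Derivatives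

/-! ### Second-order tangent sets -/

section SecondOrder

variable {E : Type*} [NormedAddCommGroup E] [NormedSpace ℝ E]

/-- The second-order tangent set, described by the points of `C` instead of their second-order
difference quotients. -/
theorem mem_tangentSet2_iff {C : Set E} {x w u : E} :
    u ∈ tangentSet2 C x w ↔ ∃ (t : ℕ → ℝ) (y : ℕ → E), (∀ k, 0 < t k) ∧
      Tendsto t atTop (𝓝 0) ∧ (∀ k, y k ∈ C) ∧
      Tendsto (fun k => (1 / 2 * t k ^ 2)⁻¹ • (y k - x - t k • w)) atTop (𝓝 u) := by
  constructor
  · rintro ⟨t, v, ht, ht0, hv, hC⟩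
    refine ⟨t, _, ht, ht0, hC, hv.congr fun k => ?_⟩
    have : (1 / 2 * t k ^ 2) ≠ 0 := by have := ht k; positivity
    rw [show x + t k • w + (1 / 2 * t k ^ 2) • v k - x - t k • w = (1 / 2 * t k ^ 2) • v k by abel,
      inv_smul_smul₀ this]
  · rintro ⟨t, y, ht, ht0, hC, hy⟩
    refine ⟨t, _, ht, ht0, hy, fun k => ?_⟩
    have : (1 / 2 * t k ^ 2) ≠ 0 := by have := ht k; positivity
    rw [smul_inv_smul₀ this]
    convert hC k using 1
    abel

/-- In a finite-dimensional space, bounded second-order difference quotients have a cluster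
point. -/
theorem tangentSet2_nonempty_of_bounded [ProperSpace E] {C : Set E} {x w : E} {t : ℕ → ℝ}
    {y : ℕ → E} (ht : ∀ k, 0 < t k) (ht0 : Tendsto t atTop (𝓝 0)) (hC : ∀ k, y k ∈ C) {R : ℝ}
    (hR : ∀ k, ‖(1 / 2 * t k ^ 2)⁻¹ • (y k - x - t k • w)‖ ≤ R) :
    (tangentSet2 C x w).Nonempty := by
  obtain ⟨u, -, φ, hφ, hu⟩ := tendsto_subseq_of_bounded
    (Metric.isBounded_closedBall (x := (0 : E)) (r := R)) fun k => mem_closedBall_zero_iff.2 (hR k)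
  exact ⟨u, mem_tangentSet2_iff.2 ⟨t ∘ φ, y ∘ φ, fun k => ht _, ht0.comp hφ.tendsto_atTop,
    fun k => hC _, hu⟩⟩

theorem tendsto_quot_of_tendsto_quot2 {ξ : ℝ → E} {x w u : E}
    (h : Tendsto (fun t : ℝ => (1 / 2 * t ^ 2)⁻¹ • (ξ t - x - t • w)) (𝓝[>] 0) (𝓝 u)) :
    Tendsto (fun t : ℝ => t⁻¹ • (ξ t - x)) (𝓝[>] 0) (𝓝 w) := by
  have ht : Tendsto (fun t : ℝ => 1 / 2 * t) (𝓝[>] 0) (𝓝 (1 / 2 * 0)) :=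
    (Continuous.tendsto (by fun_prop) 0).mono_left nhdsWithin_le_nhds
  have h1 := (ht.smul h).add_const w
  rw [mul_zero, zero_smul, zero_add] at h1
  refine h1.congr' ?_
  filter_upwards [self_mem_nhdsWithin] with t (ht : 0 < t)
  rw [smul_smul, show 1 / 2 * t * (1 / 2 * t ^ 2)⁻¹ = t⁻¹ by field_simp, smul_sub,
    inv_smul_smul₀ ht.ne']
  abel

theorem norm_inv_smul_sub_inv_smul {E : Type*} [SeminormedAddCommGroup E] [NormedSpace ℝ E]
    (s : ℝ) (a b : E) :
    ‖s⁻¹ • a - s⁻¹ • b‖ = |s|⁻¹ * ‖a - b‖ := by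
  rw [← smul_sub, norm_smul, norm_inv, Real.norm_eq_abs]

theorem norm_inv_smul_sub {E : Type*} [SeminormedAddCommGroup E] [NormedSpace ℝ E]
    {s : ℝ} (hs : s ≠ 0) (a u : E) : ‖s⁻¹ • a - u‖ = |s|⁻¹ * ‖a - s • u‖ := by
  conv_lhs => rw [← inv_smul_smul₀ hs u, norm_inv_smul_sub_inv_smul]

end SecondOrder

/-! ### Spectral sets -/

section SpectralSets

open scoped Matrix.Norms.L2Operator

variable {n : ℕ} {Θ : Set (Fin n → ℝ)}

theorem conj_diag_mem_spectralSet (hΘ : IsSymmetricSet Θ) (U : Matrix.unitaryGroup (Fin n) ℝ)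
    {y : Fin n → ℝ} (hy : y ∈ Θ) : conj U (diag y) ∈ spectralSet Θ := by
  obtain ⟨σ, hσ⟩ := exists_perm_eig_conj_diag U y
  change eig _ ∈ Θ
  rw [hσ]
  exact (hΘ σ y).2 hy

/-- A point `y` of a symmetric set `Θ` near `λ(Z)` lifts to the point `U diag(y) Uᵀ` of the spectral
set, where `U` diagonalizes `Z`; its distance from `Z` is that of `y` from `λ(Z)`. -/
theorem exists_lift (Z : Sym n) : ∃ U : Matrix.unitaryGroup (Fin n) ℝ,
    conj U (diag (eig Z)) = Z ∧ ∀ y, ‖conj U (diag y) - Z‖ = ‖y - eig Z‖ := by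
  obtain ⟨U, hU⟩ := exists_eq_conj_diag_eig Z
  refine ⟨U, hU.symm, fun y => ?_⟩
  conv_lhs => rw [hU, norm_conj_diag_sub]

/-- If the second-order difference quotients of `y` tend to `λ''(X; H, W)`, then those of its lift
tend to `W`. -/
theorem tendsto_lift {α : Type*} {l : Filter α} {X H W : Sym n} {t : α → ℝ} {y : α → Fin n → ℝ}
    {U : ℝ → Matrix.unitaryGroup (Fin n) ℝ}
    (hU : ∀ s y, ‖conj (U s) (diag y) - (X + s • H + (1 / 2 * s ^ 2) • W)‖ =
      ‖y - eig (X + s • H + (1 / 2 * s ^ 2) • W)‖)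
    (ht : Tendsto t l (𝓝[>] 0))
    (hy : Tendsto (fun a => (1 / 2 * t a ^ 2)⁻¹ • (y a - eig X - t a • eigDeriv X H)) l
      (𝓝 (eigDeriv2 X H W))) :
    Tendsto (fun a => (1 / 2 * t a ^ 2)⁻¹ • (conj (U (t a)) (diag (y a)) - X - t a • H)) l
      (𝓝 W) := by
  rw [tendsto_iff_norm_sub_tendsto_zero]
  have h := (hy.sub ((tendsto_quot2 X H W).comp ht)).norm
  rw [sub_self, norm_zero] at h
  refine h.congr' ?_
  filter_upwards [ht self_mem_nhdsWithin] with a (ha : 0 < t a)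
  have hs : (1 / 2 * t a ^ 2) ≠ 0 := by positivity
  refine Eq.trans ?_ (norm_inv_smul_sub hs _ _).symm
  rw [Function.comp_apply, norm_inv_smul_sub_inv_smul]
  congr 1
  rw [show ∀ A : Sym n, A - X - t a • H - (1 / 2 * t a ^ 2) • W =
    A - (X + t a • H + (1 / 2 * t a ^ 2) • W) from fun A => by abel, hU]
  congr 1
  abel

theorem tendsto_nhdsGT_of_pos {t : ℕ → ℝ} (ht : ∀ k, 0 < t k) (ht0 : Tendsto t atTop (𝓝 0)) :
    Tendsto t atTop (𝓝[>] 0) :=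
  tendsto_nhdsWithin_iff.2 ⟨ht0, Eventually.of_forall ht⟩

/-- If the second-order difference quotients of `Y` tend to `W`, then those of `λ(Y)` tend to
`λ''(X; H, W)`. -/
theorem tendsto_eig_of_tendsto {α : Type*} {l : Filter α} {X H W : Sym n} {t : α → ℝ}
    {Y : α → Sym n} (ht : Tendsto t l (𝓝[>] 0))
    (hY : Tendsto (fun a => (1 / 2 * t a ^ 2)⁻¹ • (Y a - X - t a • H)) l (𝓝 W)) :
    Tendsto (fun a => (1 / 2 * t a ^ 2)⁻¹ • (eig (Y a) - eig X - t a • eigDeriv X H)) l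
      (𝓝 (eigDeriv2 X H W)) := by
  have h0 := tendsto_iff_norm_sub_tendsto_zero.1 hY
  refine ((tendsto_quot2 X H W).comp ht).congr_dist (squeeze_zero' (Eventually.of_forall
    fun _ => dist_nonneg) ?_ h0)
  filter_upwards [ht self_mem_nhdsWithin] with a (ha : 0 < t a)
  have hs : (1 / 2 * t a ^ 2) ≠ 0 := by positivity
  refine le_of_le_of_eq ?_ (norm_inv_smul_sub hs _ _).symm
  rw [Function.comp_apply, dist_comm, dist_eq_norm, norm_inv_smul_sub_inv_smul]
  refine mul_le_mul_of_nonneg_left ?_ (by positivity)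
  rw [sub_sub_sub_cancel_right, sub_sub_sub_cancel_right]
  refine (norm_eig_sub_le _ _).trans_eq (congrArg _ ?_)
  abel

/-- The chain rule for second-order tangent sets of spectral sets. -/
theorem mem_tangentSet2_spectralSet_iff (hΘ : IsSymmetricSet Θ) {X H W : Sym n} :
    W ∈ tangentSet2 (spectralSet Θ) X H ↔
      eigDeriv2 X H W ∈ tangentSet2 Θ (eig X) (eigDeriv X H) := by
  rw [mem_tangentSet2_iff, mem_tangentSet2_iff]
  constructor
  · rintro ⟨t, Y, ht, ht0, hC, hY⟩
    exact ⟨t, fun k => eig (Y k), ht, ht0, hC,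
      tendsto_eig_of_tendsto (tendsto_nhdsGT_of_pos ht ht0) hY⟩
  · rintro ⟨t, y, ht, ht0, hC, hy⟩
    choose U hU using fun s : ℝ => exists_lift (X + s • H + (1 / 2 * s ^ 2) • W)
    exact ⟨t, _, ht, ht0, fun k => conj_diag_mem_spectralSet hΘ _ (hC k),
      tendsto_lift (fun s => (hU s).2) (tendsto_nhdsGT_of_pos ht ht0) hy⟩

/-- Parabolic derivability passes from a symmetric set to its spectral set. -/
theorem parabolicallyDerivable_spectralSet (hΘ : IsSymmetricSet Θ) {X H : Sym n}
    (h : ParabolicallyDerivable Θ (eig X) (eigDeriv X H)) :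
    ParabolicallyDerivable (spectralSet Θ) X H := by
  obtain ⟨⟨u, hu⟩, harc⟩ := h
  refine ⟨?_, fun W hW => ?_⟩
  · -- lift the points of `Θ` along `X + tH`: the difference quotients stay bounded
    obtain ⟨t, y, ht, ht0, hC, hy⟩ := mem_tangentSet2_iff.1 hu
    choose U hU using fun s : ℝ => exists_lift (X + s • H)
    have hq := (tendsto_quot2 X H 0).comp (tendsto_nhdsGT_of_pos ht ht0)
    obtain ⟨R, hR⟩ := (Metric.isBounded_range_of_tendsto _ (hy.sub hq)).exists_norm_le
    refine tangentSet2_nonempty_of_bounded ht ht0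
      (fun k => conj_diag_mem_spectralSet hΘ (U (t k)) (hC k)) (R := R) fun k => ?_
    refine le_of_eq_of_le ?_ (hR _ ⟨k, rfl⟩)
    beta_reduce
    rw [Function.comp_apply, norm_inv_smul_sub_inv_smul, norm_smul, norm_inv, Real.norm_eq_abs,
      sub_sub, (hU (t k)).2, smul_zero, add_zero, sub_sub_sub_cancel_right,
      sub_sub_sub_cancel_right]
  · obtain ⟨ε, hε, ξ, hξ, hξ0, -, hξ2⟩ :=
      harc _ ((mem_tangentSet2_spectralSet_iff hΘ).1 hW)
    choose U hU using fun s : ℝ => exists_lift (X + s • H + (1 / 2 * s ^ 2) • W)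
    have h0 : conj (U 0) (diag (ξ 0)) = X := by
      have := (hU 0).1
      rw [hξ0]
      simpa using this
    rw [hξ0] at hξ2
    have h2 := tendsto_lift (fun s => (hU s).2) tendsto_id hξ2
    refine ⟨ε, hε, fun t => conj (U t) (diag (ξ t)),
      fun t ht => conj_diag_mem_spectralSet hΘ _ (hξ t ht), h0, ?_, ?_⟩
    · simp only [h0]
      exact tendsto_quot_of_tendsto_quot2 h2
    · simp only [h0]
      exact h2

/-- A matrix `Y` of the spectral set near `U diag(z) Uᵀ` gives a point of `Θ` near `z`, obtained by
permuting the entries of `λ(Y)`. -/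
theorem exists_mem_norm_sub_le (hΘ : IsSymmetricSet Θ) (U : Matrix.unitaryGroup (Fin n) ℝ)
    (z : Fin n → ℝ) (Y : Sym n) : ∃ y : Fin n → ℝ, (Y ∈ spectralSet Θ → y ∈ Θ) ∧
      ‖y - z‖ ≤ ‖Y - conj U (diag z)‖ := by
  obtain ⟨σ, hσ⟩ := exists_perm_eig_conj_diag U z
  refine ⟨eig Y ∘ σ.symm, fun hY => (hΘ _ _).2 hY, ?_⟩
  have h := norm_eig_sub_le Y (conj U (diag z))
  rw [hσ] at h
  refine ((pi_norm_le_iff_of_nonneg (norm_nonneg _)).2 fun i => ?_).trans h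
  simpa using norm_le_pi_norm (eig Y - z ∘ σ) (σ.symm i)

/-- Parabolic derivability passes from the spectral set to the symmetric set: a direction `v` is
represented by `U diag(v) Uᵀ`, where `U` diagonalizes `X`. -/
theorem parabolicallyDerivable_of_spectralSet (hΘ : IsSymmetricSet Θ) {X : Sym n}
    (h : ∀ H ∈ tangentCone (spectralSet Θ) X, ParabolicallyDerivable (spectralSet Θ) X H)
    {v : Fin n → ℝ} (hv : v ∈ tangentCone Θ (eig X)) : ParabolicallyDerivable Θ (eig X) v := by
  obtain ⟨U, hU, -⟩ := exists_lift X
  have hline : ∀ (t : ℝ) (w : Fin n → ℝ),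
      X + t • conj U (diag w) = conj U (diag (eig X + t • w)) := fun t w => by
    simp only [map_add, map_smul, hU]
  have hcurve : ∀ (t s : ℝ) (w u : Fin n → ℝ), X + t • conj U (diag w) + s • conj U (diag u) =
      conj U (diag (eig X + t • w + s • u)) := fun t s w u => by
    simp only [map_add, map_smul, hU]
  have hcont : Continuous fun w : Fin n → ℝ => conj U (diag w) :=
    ((conj U).comp diag).continuous_of_finiteDimensional
  obtain ⟨hne, harc⟩ := h (conj U (diag v)) (by
    obtain ⟨t, w, ht, ht0, hw, hC⟩ := hv
    exact ⟨t, fun k => conj U (diag (w k)), ht, ht0, (hcont.tendsto v).comp hw, fun k => by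
      rw [hline]
      exact conj_diag_mem_spectralSet hΘ U (hC k)⟩)
  -- matrices near `X + tH + (t²/2)W`, where `H = U diag(v) Uᵀ` and `W = U diag(u) Uᵀ`
  have hdown : ∀ (u : Fin n → ℝ) (t : ℝ) (Y : Sym n), ∃ y : Fin n → ℝ,
      (Y ∈ spectralSet Θ → y ∈ Θ) ∧ ‖y - eig X - t • v - (1 / 2 * t ^ 2) • u‖ ≤
        ‖Y - X - t • conj U (diag v) - (1 / 2 * t ^ 2) • conj U (diag u)‖ := fun u t Y => by
    obtain ⟨y, hy, hy'⟩ := exists_mem_norm_sub_le hΘ U (eig X + t • v + (1 / 2 * t ^ 2) • u) Y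
    refine ⟨y, hy, ?_⟩
    rwa [sub_sub, sub_sub, sub_sub, sub_sub, ← add_assoc, ← add_assoc, hcurve]
  refine ⟨?_, fun u hu => ?_⟩
  · obtain ⟨W, hW⟩ := hne
    obtain ⟨t, Y, ht, ht0, hC, hY⟩ := mem_tangentSet2_iff.1 hW
    obtain ⟨R, hR⟩ := (Metric.isBounded_range_of_tendsto _ hY).exists_norm_le
    choose y hy hy' using fun k => hdown 0 (t k) (Y k)
    refine tangentSet2_nonempty_of_bounded ht ht0 (fun k => hy k (hC k)) (R := R) fun k => ?_
    refine le_trans ?_ (hR _ ⟨k, rfl⟩)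
    rw [norm_smul, norm_smul]
    refine mul_le_mul_of_nonneg_left ?_ (norm_nonneg _)
    simpa using hy' k
  · obtain ⟨ε, hε, ξ, hξ, hξ0, -, hξ2⟩ := harc (conj U (diag u)) (by
      obtain ⟨t, w, ht, ht0, hw, hC⟩ := hu
      exact ⟨t, fun k => conj U (diag (w k)), ht, ht0, (hcont.tendsto u).comp hw, fun k => by
        rw [hcurve]
        exact conj_diag_mem_spectralSet hΘ U (hC k)⟩)
    choose η hη hη' using fun t => hdown u t (ξ t)
    have h0 : η 0 = eig X := by
      have := hη' 0
      simp only [hξ0, sub_self, zero_smul, ne_eq, OfNat.ofNat_ne_zero, not_false_eq_true, zero_pow,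
        mul_zero, sub_zero, norm_zero, norm_le_zero_iff] at this
      exact sub_eq_zero.1 this
    have h2 : Tendsto (fun t : ℝ => (1 / 2 * t ^ 2)⁻¹ • (η t - eig X - t • v)) (𝓝[>] 0)
        (𝓝 u) := by
      rw [hξ0] at hξ2
      rw [tendsto_iff_norm_sub_tendsto_zero] at hξ2 ⊢
      refine squeeze_zero' (Eventually.of_forall fun _ => norm_nonneg _) ?_ hξ2
      filter_upwards [self_mem_nhdsWithin] with t (ht : 0 < t)
      have hs : (1 / 2 * t ^ 2) ≠ 0 := by positivity
      refine (norm_inv_smul_sub hs _ _).trans_le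
        (le_of_le_of_eq ?_ (norm_inv_smul_sub hs _ _).symm)
      exact mul_le_mul_of_nonneg_left (hη' t) (by positivity)
    refine ⟨ε, hε, η, fun t ht => hη t (hξ t ht), h0, ?_, ?_⟩
    · rw [h0]
      exact tendsto_quot_of_tendsto_quot2 h2
    · rw [h0]
      exact h2

end SpectralSets

end SpectralVar

theorem theorem4p3 (n : ℕ) (Θ : Set (Fin n → ℝ)) (hΘ : SpectralVar.IsSymmetricSet Θ)
    (C : Set (SpectralVar.Sym n)) (hC : C = SpectralVar.spectralSet Θ)
    (X : SpectralVar.Sym n) (hX : X ∈ C)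
    (H : SpectralVar.Sym n) (hH : H ∈ SpectralVar.tangentCone C X) :
    -- the limits defining `λ'(X; H)` and `λ''(X; H, W)` exist
    (∀ i, Tendsto (SpectralVar.eigQuot X H i) (𝓝[>] 0) (𝓝 (SpectralVar.eigDeriv X H i))) ∧
    (∀ W i, Tendsto (SpectralVar.eigQuot2 X H W i) (𝓝[>] 0)
      (𝓝 (SpectralVar.eigDeriv2 X H W i))) ∧
    -- the chain rule for second-order tangent sets
    SpectralVar.tangentSet2 C X H =
      {W | SpectralVar.eigDeriv2 X H W ∈
        SpectralVar.tangentSet2 Θ (SpectralVar.eig X) (SpectralVar.eigDeriv X H)} ∧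
    -- (a)
    (SpectralVar.ParabolicallyDerivable Θ (SpectralVar.eig X) (SpectralVar.eigDeriv X H) →
      SpectralVar.ParabolicallyDerivable C X H) ∧
    -- (b)
    ((∀ H' ∈ SpectralVar.tangentCone C X, SpectralVar.ParabolicallyDerivable C X H') →
      ∀ v ∈ SpectralVar.tangentCone Θ (SpectralVar.eig X),
        SpectralVar.ParabolicallyDerivable Θ (SpectralVar.eig X) v) := by
  subst hC
  exact ⟨SpectralVar.tendsto_eigQuot X H, SpectralVar.tendsto_eigQuot2 X H,
    Set.ext fun _ => SpectralVar.mem_tangentSet2_spectralSet_iff hΘ,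
    SpectralVar.parabolicallyDerivable_spectralSet hΘ,
    fun h _ => SpectralVar.parabolicallyDerivable_of_spectralSet hΘ h⟩
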